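/- Let $d$ be a natural number and let $\mathcal C$ be a crystal framework in $\mathbb R^d$. That is, we are given linearly independent period vectors $a_1,\dots,a_d\in\mathbb R^d$, with the translations $T_kx=x+\sum_i k_ia_i$ for $k\in\mathbb Z^d$, and finitely many points $p_{1,0},\dots,p_{t,0}$ such that the framework vertices $p_{\kappa,k}=T_kp_{\kappa,0}$ ($1\le\kappa\le t$, $k\in\mathbb Z^d$) are pairwise distinct. We are also given a simple graph on the labels $(\kappa,k)$ whose edge set is the disjoint union, over $k\in\mathbb Z^d$, of the translates by $k$ (the shift $(\kappa,m)\mapsto(\kappa,m+k)$ of labels) of a finite set of edges. (Connectedness is not required.) A family $u=(u_{\kappa,k})$ of vectors in $\mathbb R^d$ (or $\mathbb C^d$) is a real (or complex) infinitesimal flex, i.e. lies in the nullspace of the rigidity matrix $R(\mathcal C)$, if $\sum_{\sigma=1}^d (p_{\kappa,k}-p_{\tau,l})_\sigma\,(u_{\kappa,k}-u_{\tau,l})_\sigma=0$ for every edge with ends $(\kappa,k)$, $(\tau,l)$. A local floppy mode is a nonzero real infinitesimal flex $u$ such that, for all but finitely many $k$, $u_{\kappa,k}=0$ for all $\kappa$.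 For an integer $n\ge 1$ let $\nu_n$ be the dimension of the real vector space of the real infinitesimal flexes $u$ with $u_{\kappa,k+m}=u_{\kappa,k}$ for all $\kappa$, $k\in\mathbb Z^d$ and $m\in n\mathbb Z^d$. Let $\mathbb T^d=\{\omega\in\mathbb C^d:|\omega_1|=\dots=|\omega_d|=1\}$ and write $\omega^k=\omega_1^{k_1}\cdots\omega_d^{k_d}$. The RUM spectrum $\Omega(\mathcal C)$ is the set of all $\omega\in\mathbb T^d$ for which there is a nonzero complex infinitesimal flex $u$ with $u_{\kappa,k}=\omega^ku_{\kappa,0}$ for all $\kappa,k$. Its dimension is its dimension as a real algebraic variety in $\mathbb C^d\cong\mathbb R^{2d}$, i.e. the Krull dimension of the quotient of the real polynomial ring in $2d$ variables by the ideal of the polynomials that vanish on $\Omega(\mathcal C)$ (the empty set has dimension $-\infty$). Then the following assertions are equivalent. (i) $\mathcal C$ has a local floppy mode. (ii) There is a constant $c>0$ such that $\nu_n\ge c\,n^d$ for all integers $n\ge 1$. (iii) $\dim\Omega(\mathcal C)=d$. (iv) $\Omega(\mathcal C)=\mathbb T^d$. -/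

import Mathlib

/-- Labels `(κ, k)` of the framework vertices of a crystal framework in `ℝ^d`:
`κ` labels a motif vertex and `k ∈ ℤ^d` a unit cell. -/
abbrev VertexLabel (t d : ℕ) : Type := Fin t × (Fin d → ℤ)

/-- The shift `(κ, m) ↦ (κ, m + k)` of vertex labels, which corresponds to the translation `T_k`. -/
def VertexLabel.shift {t d : ℕ} (k : Fin d → ℤ) (v : VertexLabel t d) : VertexLabel t d :=
  (v.1, v.2 + k)

/-- The vector `k₁ a₁ + ⋯ + k_d a_d` of the translation `T_k`, for period vectors `a₁, …, a_d`. -/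
noncomputable def latticeVector {d : ℕ} (a : Fin d → EuclideanSpace ℝ (Fin d)) (k : Fin d → ℤ) :
    EuclideanSpace ℝ (Fin d) :=
  ∑ i, (k i : ℝ) • a i

/-- A crystal framework in `ℝ^d` with a full rank translation group and a finite motif.
It need not be connected, and a motif edge need not have an end in the motif vertex set. -/
structure CrystalFramework (d : ℕ) where
  /-- the number `|F_v|` of motif vertices -/
  numVertices : ℕ
  /-- the motif vertices `p_{κ,0}` -/
  motifVertex : Fin numVertices → EuclideanSpace ℝ (Fin d)
  /-- the period vectors, which generate the translation group `{T_k : k ∈ ℤ^d}` -/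
  period : Fin d → EuclideanSpace ℝ (Fin d)
  /-- the translation group has full rank -/
  period_linearIndependent : LinearIndependent ℝ period
  /-- the motif vertices are distinct and the translates `T_k(F_v)` are pairwise disjoint -/
  vertex_injective : Function.Injective fun v : VertexLabel numVertices d =>
    motifVertex v.1 + latticeVector period v.2
  /-- the underlying simple graph -/
  graph : SimpleGraph (VertexLabel numVertices d)
  /-- the finite set `F_e` of motif edges -/
  motifEdges : Finset (Sym2 (VertexLabel numVertices d))
  /-- the edge set is the union of the translates `T_k(F_e)` … -/
  edgeSet_eq : graph.edgeSet = ⋃ k : Fin d → ℤ,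
    Sym2.map (VertexLabel.shift (t := numVertices) k) '' (motifEdges : Set _)
  /-- … and this union is disjoint -/
  edge_disjoint : Pairwise fun k l : Fin d → ℤ =>
    Disjoint (Sym2.map (VertexLabel.shift (t := numVertices) k) '' (motifEdges : Set _))
      (Sym2.map (VertexLabel.shift (t := numVertices) l) '' (motifEdges : Set _))

namespace CrystalFramework

variable {d : ℕ} (C : CrystalFramework d)

/-- The vertex labels of the framework. -/
abbrev Vertex : Type := VertexLabel C.numVertices d

/-- The framework vertex `p_{κ,k} = T_k p_{κ,0}`. -/
noncomputable def position (v : C.Vertex) : EuclideanSpace ℝ (Fin d) :=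
  C.motifVertex v.1 + latticeVector C.period v.2

/-- Displacement vectors `u = (u_{κ,k})` with scalars in `𝕜`; the real ones form `H_atom`, the
complex ones form `K_atom`. -/
abbrev Displacement (𝕜 : Type) : Type := C.Vertex → Fin d → 𝕜

/-- The product of row `e` of the rigidity matrix with the displacement vector `u`. The row of
the edge with ends `v`, `w` is `p_v - p_w` in the columns of `v`, `p_w - p_v` in the columns
of `w`, and zero elsewhere, so that the product is
`∑_σ (p_v - p_w)_σ (u_v - u_w)_σ`. -/
noncomputable def rigidityRow {𝕜 : Type} [RCLike 𝕜] (u : C.Displacement 𝕜) : Sym2 C.Vertex → 𝕜 :=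
  Sym2.lift ⟨fun v w =>
    ∑ σ, ((C.position v σ - C.position w σ : ℝ) : 𝕜) * (u v σ - u w σ), fun v w => by
      refine Finset.sum_congr rfl fun σ _ => ?_
      push_cast
      ring⟩

/-- The linear transformation `u ↦ R(C) u` given by the rigidity matrix, from displacement vectors
to families of scalars labelled by the framework edges. Its kernel is the space of
infinitesimal flexes. -/
noncomputable def rigidityMap (𝕜 : Type) [RCLike 𝕜] :
    C.Displacement 𝕜 →ₗ[𝕜] (C.graph.edgeSet → 𝕜) where
  toFun u e := C.rigidityRow u e
  map_add' u u' := by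
    funext ⟨e, he⟩
    induction e using Sym2.ind with
    | _ v w =>
      simp only [rigidityRow, Sym2.lift_mk, Pi.add_apply, ← Finset.sum_add_distrib]
      refine Finset.sum_congr rfl fun σ _ => ?_
      ring
  map_smul' c u := by
    funext ⟨e, he⟩
    induction e using Sym2.ind with
    | _ v w =>
      simp only [rigidityRow, Sym2.lift_mk, Pi.smul_apply, smul_eq_mul, RingHom.id_apply,
        Finset.mul_sum]
      refine Finset.sum_congr rfl fun σ _ => ?_
      ring

/-- A local floppy mode: a nonzero real vector in the nullspace of `R(C)` with `u_{κ,k} = 0` for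
all but finitely many `k`. -/
def IsLocalFloppyMode (u : C.Displacement ℝ) : Prop :=
  u ≠ 0 ∧ C.rigidityMap ℝ u = 0 ∧ {k : Fin d → ℤ | ∃ κ, u (κ, k) ≠ 0}.Finite

/-- The space of real displacement vectors that are periodic for the supercell
`r = (r₁, …, r_d)`: `u_{κ,k+m} = u_{κ,k}` whenever `r_i` divides `m_i` for all `i`. -/
def periodicDisplacements (r : Fin d → ℕ) : Submodule ℝ (C.Displacement ℝ) where
  carrier := {u | ∀ κ k m, (∀ i, (r i : ℤ) ∣ m i) → u (κ, k + m) = u (κ, k)}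
  add_mem' hu hv κ k m h := by simp [hu κ k m h, hv κ k m h]
  zero_mem' _ _ _ _ := rfl
  smul_mem' c u hu κ k m h := by simp [hu κ k m h]

/-- The nullity `ν_n = dim ker R^{(r)}`, `r = (n, …, n)`, where `R^{(r)}` is the restriction of
`R(C)` to the `r`-periodic real displacement vectors. It is meant for `n ≥ 1`. -/
noncomputable def nullity (n : ℕ) : ℕ :=
  Module.finrank ℝ
    (LinearMap.ker ((C.rigidityMap ℝ).domRestrict (C.periodicDisplacements fun _ => n)))

/-- The monomial `ω^k = ω₁^{k₁} ⋯ ω_d^{k_d}` at a point `ω` of the torus `𝕋^d`. -/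
noncomputable def phase (ω : Fin d → Circle) (k : Fin d → ℤ) : ℂ :=
  ((∏ i, ω i ^ k i : Circle) : ℂ)

/-- The space `K^ω_a` of complex displacement vectors with `u_{κ,k} = ω^k u_{κ,0}`. -/
def phasePeriodicDisplacements (ω : Fin d → Circle) : Submodule ℂ (C.Displacement ℂ) where
  carrier := {u | ∀ κ k, u (κ, k) = phase ω k • u (κ, 0)}
  add_mem' hu hv κ k := by
    simp only [Pi.add_apply, smul_add, ← hu κ k, ← hv κ k]
  zero_mem' _ _ := by simp
  smul_mem' c u hu κ k := by
    simp only [Pi.smul_apply, smul_comm _ c, ← hu κ k]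

/-- The RUM spectrum `Ω(C)`: the points `ω` of `𝕋^d` for which the restriction `R^ω` of `R(C)` to
the displacement vectors that are periodic modulo the phase `ω` has a nonzero kernel. -/
def rumSpectrum : Set (Fin d → Circle) :=
  {ω | LinearMap.ker ((C.rigidityMap ℂ).domRestrict (C.phasePeriodicDisplacements ω)) ≠ ⊥}

end CrystalFramework

/-- The real coordinates `(Re ω₁, …, Re ω_d, Im ω₁, …, Im ω_d) ∈ ℝ^{2d}` of a point
of `𝕋^d ⊆ ℂ^d`. -/
noncomputable def torusRealCoord {d : ℕ} (ω : Fin d → Circle) : Fin d ⊕ Fin d → ℝ :=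
  Sum.elim (fun i => (ω i : ℂ).re) (fun i => (ω i : ℂ).im)

/-- The dimension of a real algebraic subset of the torus `𝕋^d ⊆ ℝ^{2d}`: the Krull dimension of
its ring of polynomial functions, that is, of the quotient of the real polynomial ring in `2d`
variables by the ideal of the polynomials that vanish on the set (`⊥` for the empty set). -/
noncomputable def realVarietyDim {d : ℕ} (S : Set (Fin d → Circle)) : WithBot ℕ∞ :=
  ringKrullDim (MvPolynomial (Fin d ⊕ Fin d) ℝ ⧸
    MvPolynomial.vanishingIdeal ℝ (torusRealCoord '' S))

/-! The proof runs (i) ⇒ (iv) ⇒ (ii) ⇒ (i), with (iii) ⇔ (iv) separately.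

Phase-periodic flexes are governed by a finite matrix `M(ω)` of trigonometric polynomials. Hence `Ω`
is the zero set in the torus of one real polynomial, obtained from `det (M* M)`
(`exists_polynomial_rumSpectrum`). The torus is the image of `ℝ^d` under a real analytic map, so its
vanishing ideal is prime, and its dimension is `d`. A zero set smaller than the torus therefore has
smaller dimension, which gives (iii) ⇔ (iv).

(i) ⇒ (iv): the Fourier transform of a local floppy mode is a nonzero trigonometric polynomial with
`M(ω) û(ω) = 0`, so `Ω` contains every `ω` where `û(ω) ≠ 0`; primality extends this to the whole
torus.

(iv) ⇒ (ii): the `n^d` points whose coordinates are `n`-th roots of unity give independent complex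
`n`-periodic flexes, so `c = 1` works (`pow_le_nullity`).

(ii) ⇒ (i): vanishing on a boundary layer of the supercell costs `O(n^(d-1))` linear conditions,
fewer than `c n^d` for large `n`. A nonzero periodic flex meeting them can be cut off outside one
supercell. -/

section

open MvPolynomial Set

/-! ### Dimension of the torus and of its algebraic subsets -/

/-- Polynomials vanishing on the image of a normed space under a real analytic map form a prime
ideal. -/
theorem isPrime_vanishingIdeal_range {E σ : Type*} [NormedAddCommGroup E] [NormedSpace ℝ E]
    {f : E → σ → ℝ} (hf : ∀ i, AnalyticOnNhd ℝ (fun x => f x i) univ) :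
    (MvPolynomial.vanishingIdeal ℝ (range f)).IsPrime := by
  refine ⟨?_, ?_⟩
  · rw [Ne, Ideal.eq_top_iff_one, mem_vanishingIdeal_iff]
    intro h
    simpa using h (f 0) ⟨0, rfl⟩
  · intro p q hpq
    by_contra! hcon
    obtain ⟨hp, hq⟩ := hcon
    apply hq
    simp only [mem_vanishingIdeal_iff, forall_mem_range, not_forall] at hp hpq ⊢
    obtain ⟨x, hx⟩ := hp
    have hap : AnalyticOnNhd ℝ (fun x => aeval (f x) p) univ :=
      AnalyticOnNhd.aeval_mvPolynomial hf p
    have haq : AnalyticOnNhd ℝ (fun x => aeval (f x) q) univ :=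
      AnalyticOnNhd.aeval_mvPolynomial hf q
    -- Near `x` the factor `p` has no zero, so `q` vanishes there, and by the identity theorem
    -- everywhere.
    have hne : ∀ᶠ y in nhds x, aeval (f y) p ≠ 0 :=
      (hap x (mem_univ x)).continuousAt.eventually_ne hx
    have hev : (fun x => aeval (f x) q) =ᶠ[nhds x] fun _ => 0 := by
      filter_upwards [hne] with y hy
      have := hpq y
      rw [map_mul] at this
      exact (mul_eq_zero.mp this).resolve_left hy
    exact congrFun (haq.eq_of_eventuallyEq analyticOnNhd_const hev)

/-- The point of the torus with angles `θ i` for `j ≤ i` and `0` for `i < j`. -/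
noncomputable def torusFace {d : ℕ} (j : ℕ) (θ : Fin d → ℝ) : Fin d → Circle :=
  fun i => if (i : ℕ) < j then 1 else Circle.exp (θ i)

theorem torusFace_zero_surjective {d : ℕ} : Function.Surjective (torusFace (d := d) 0) := by
  intro ω
  refine ⟨fun i => Complex.arg (ω i), ?_⟩
  funext i
  simp [torusFace]

/-- The ideal of the polynomials that vanish on the subtorus `ω₁ = ⋯ = ω_j = 1`. -/
noncomputable def faceIdeal (d j : ℕ) : Ideal (MvPolynomial (Fin d ⊕ Fin d) ℝ) :=
  MvPolynomial.vanishingIdeal ℝ (range fun θ : Fin d → ℝ => torusRealCoord (torusFace j θ))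

theorem mem_faceIdeal {d j : ℕ} {p : MvPolynomial (Fin d ⊕ Fin d) ℝ} :
    p ∈ faceIdeal d j ↔ ∀ θ : Fin d → ℝ, aeval (torusRealCoord (torusFace j θ)) p = 0 := by
  simp [faceIdeal]

instance isPrime_faceIdeal (d j : ℕ) : (faceIdeal d j).IsPrime := by
  apply isPrime_vanishingIdeal_range
  rintro (i | i)
  · by_cases h : (i : ℕ) < j
    · simpa [torusRealCoord, torusFace, h] using analyticOnNhd_const
    · simp only [torusRealCoord, torusFace, h, if_false, Sum.elim_inl, Circle.coe_exp,
        Complex.exp_ofReal_mul_I_re]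
      intro x _
      have h : AnalyticAt ℝ (fun y : Fin d → ℝ => y i) x :=
        (ContinuousLinearMap.proj (R := ℝ) (φ := fun _ => ℝ) i).analyticAt x
      exact AnalyticAt.comp (f := fun y : Fin d → ℝ => y i) Real.analyticAt_cos h
  · by_cases h : (i : ℕ) < j
    · simpa [torusRealCoord, torusFace, h] using analyticOnNhd_const
    · simp only [torusRealCoord, torusFace, h, if_false, Sum.elim_inr, Circle.coe_exp,
        Complex.exp_ofReal_mul_I_im]
      intro x _
      have h : AnalyticAt ℝ (fun y : Fin d → ℝ => y i) x :=
        (ContinuousLinearMap.proj (R := ℝ) (φ := fun _ => ℝ) i).analyticAt x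
      exact AnalyticAt.comp (f := fun y : Fin d → ℝ => y i) Real.analyticAt_sin h

theorem mem_faceIdeal_zero {d : ℕ} {p : MvPolynomial (Fin d ⊕ Fin d) ℝ} :
    p ∈ faceIdeal d 0 ↔ ∀ ω : Fin d → Circle, aeval (torusRealCoord ω) p = 0 := by
  rw [mem_faceIdeal]
  exact (torusFace_zero_surjective.forall (p := fun ω => aeval (torusRealCoord ω) p = 0)).symm

theorem faceIdeal_zero (d : ℕ) :
    faceIdeal d 0 =
      MvPolynomial.vanishingIdeal ℝ (torusRealCoord '' (univ : Set (Fin d → Circle))) := by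
  ext p
  simp [mem_faceIdeal_zero]

theorem faceIdeal_mono (d : ℕ) : Monotone (faceIdeal d) := by
  intro j l hjl
  refine vanishingIdeal_anti_mono ?_
  rintro _ ⟨θ, rfl⟩
  refine ⟨fun i => if (i : ℕ) < l then 0 else θ i, ?_⟩
  refine congrArg torusRealCoord (funext fun i => ?_)
  by_cases h : (i : ℕ) < l <;> by_cases h' : (i : ℕ) < j <;> simp [torusFace, h, h']
  omega

/-- The polynomial `x_j - 1` separates the two: on the larger face the angle `π` gives it the value
`-2`. -/
theorem faceIdeal_lt_succ {d j : ℕ} (hj : j < d) : faceIdeal d j < faceIdeal d (j + 1) := by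
  refine lt_of_le_of_ne (faceIdeal_mono d j.le_succ) fun h => ?_
  have h1 : (X (Sum.inl ⟨j, hj⟩) - 1 : MvPolynomial (Fin d ⊕ Fin d) ℝ) ∈ faceIdeal d (j + 1) := by
    rw [mem_faceIdeal]
    intro θ
    simp [torusRealCoord, torusFace]
  rw [← h, mem_faceIdeal] at h1
  have := h1 fun _ => Real.pi
  norm_num [torusRealCoord, torusFace] at this

theorem natCast_le_realVarietyDim_univ (d : ℕ) :
    (d : WithBot ℕ∞) ≤ realVarietyDim (univ : Set (Fin d → Circle)) := by
  rw [realVarietyDim, ringKrullDim_quotient, ← faceIdeal_zero]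
  let s : LTSeries (PrimeSpectrum.zeroLocus
      (R := MvPolynomial (Fin d ⊕ Fin d) ℝ) (faceIdeal d 0)) :=
    { length := d
      toFun := fun j => ⟨⟨faceIdeal d j, inferInstance⟩, faceIdeal_mono d (Nat.zero_le _)⟩
      step := fun j => by
        change faceIdeal d _ < faceIdeal d _
        simpa using faceIdeal_lt_succ j.2 }
  exact Order.LTSeries.length_le_krullDim s

/-- Incomparability: contraction of primes along an integral map is strictly monotone. The map need
not be injective. -/
theorem ringKrullDim_le_of_isIntegral (R S : Type*) [CommRing R] [CommRing S] [Algebra R S]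
    [Algebra.IsIntegral R S] : ringKrullDim S ≤ ringKrullDim R :=
  Order.krullDim_le_of_strictMono (PrimeSpectrum.comap (algebraMap R S)) fun _ _ h =>
    Ideal.IsIntegral.comap_lt_comap h

/-- The relations `y_i ^ 2 = 1 - x_i ^ 2` make the coordinate ring of the torus integral over the
polynomial ring in the real parts `x_i` alone. -/
theorem realVarietyDim_univ_le (d : ℕ) :
    realVarietyDim (univ : Set (Fin d → Circle)) ≤ (d : WithBot ℕ∞) := by
  rw [realVarietyDim, ← faceIdeal_zero]
  let A := MvPolynomial (Fin d ⊕ Fin d) ℝ ⧸ faceIdeal d 0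
  let f : MvPolynomial (Fin d) ℝ →+* A :=
    (Ideal.Quotient.mk _).comp (rename (R := ℝ) (Sum.inl : Fin d → Fin d ⊕ Fin d)).toRingHom
  let _ : Algebra (MvPolynomial (Fin d) ℝ) A := f.toAlgebra
  have hx : ∀ i : Fin d, IsIntegral (MvPolynomial (Fin d) ℝ)
      (Ideal.Quotient.mk (faceIdeal d 0) (X (Sum.inl i))) := fun i => by
    have : Ideal.Quotient.mk (faceIdeal d 0) (X (Sum.inl i)) =
        algebraMap (MvPolynomial (Fin d) ℝ) A (X i) := by
      simp [RingHom.algebraMap_toAlgebra, f]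
    rw [this]
    exact isIntegral_algebraMap
  have hint : Algebra.IsIntegral (MvPolynomial (Fin d) ℝ) A := by
    constructor
    intro a
    obtain ⟨p, rfl⟩ := Ideal.Quotient.mk_surjective a
    induction p using MvPolynomial.induction_on with
    | C r =>
      have : Ideal.Quotient.mk (faceIdeal d 0) (C r) =
          algebraMap (MvPolynomial (Fin d) ℝ) A (C r) := by
        simp [RingHom.algebraMap_toAlgebra, f]
      rw [this]
      exact isIntegral_algebraMap
    | add p q hp hq => rw [map_add]; exact hp.add hq
    | mul_X p i hp =>
      rw [map_mul]
      refine hp.mul ?_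
      rcases i with i | i
      · exact hx i
      · refine IsIntegral.of_pow (n := 2) two_pos ?_
        have : (Ideal.Quotient.mk (faceIdeal d 0) (X (Sum.inr i))) ^ 2 =
            1 - (Ideal.Quotient.mk (faceIdeal d 0) (X (Sum.inl i))) ^ 2 := by
          rw [← map_pow, ← map_pow, ← map_one (Ideal.Quotient.mk (faceIdeal d 0)), ← map_sub,
            Ideal.Quotient.eq, mem_faceIdeal_zero]
          intro ω
          have := Circle.normSq_coe (ω i)
          rw [Complex.normSq_apply] at this
          simp only [torusRealCoord, map_sub, map_pow, aeval_X, map_one, Sum.elim_inl, Sum.elim_inr]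
          linarith
        rw [this]
        exact isIntegral_one.sub ((hx i).pow 2)
  refine (ringKrullDim_le_of_isIntegral (MvPolynomial (Fin d) ℝ) A).trans ?_
  simp [ringKrullDim_eq_zero_of_field]

theorem realVarietyDim_univ (d : ℕ) :
    realVarietyDim (univ : Set (Fin d → Circle)) = (d : WithBot ℕ∞) :=
  le_antisymm (realVarietyDim_univ_le d) (natCast_le_realVarietyDim_univ d)

/-- A set on which some polynomial vanishes that does not vanish on the torus has dimension less
than `d`. -/
theorem realVarietyDim_add_one_le {d : ℕ} {S : Set (Fin d → Circle)}
    {p : MvPolynomial (Fin d ⊕ Fin d) ℝ} (hp : p ∉ faceIdeal d 0)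
    (hS : ∀ ω ∈ S, aeval (torusRealCoord ω) p = 0) :
    realVarietyDim S + 1 ≤ (d : WithBot ℕ∞) := by
  rw [← realVarietyDim_univ, realVarietyDim, realVarietyDim, ← faceIdeal_zero]
  have hle : faceIdeal d 0 ≤ MvPolynomial.vanishingIdeal ℝ (torusRealCoord '' S) := by
    rw [faceIdeal_zero]
    exact vanishingIdeal_anti_mono (image_mono (subset_univ S))
  -- The coordinate ring of the torus is a domain, so the class of `p` is a non-zero-divisor, and
  -- killing it lowers the dimension.
  refine ringKrullDim_succ_le_of_surjective (Ideal.Quotient.factor hle)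
    (Ideal.Quotient.factor_surjective hle) (r := Ideal.Quotient.mk _ p) ?_ ?_
  · rw [mem_nonZeroDivisors_iff_ne_zero, Ne, Ideal.Quotient.eq_zero_iff_mem]
    exact hp
  · rw [Ideal.Quotient.factor_mk, Ideal.Quotient.eq_zero_iff_mem, mem_vanishingIdeal_iff]
    rintro _ ⟨ω, hω, rfl⟩
    exact hS ω hω

/-! ### Complex polynomial functions on the torus -/

/-- The complex functions on the torus whose real and imaginary parts are real polynomials in the
real coordinates. -/
noncomputable def torusPolynomial (d : ℕ) : Subalgebra ℝ ((Fin d → Circle) → ℂ) where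
  carrier := {f | ∃ p q : MvPolynomial (Fin d ⊕ Fin d) ℝ, ∀ ω, f ω =
    (aeval (torusRealCoord ω) p : ℝ) + (aeval (torusRealCoord ω) q : ℝ) * Complex.I}
  mul_mem' := by
    rintro f g ⟨p, q, hf⟩ ⟨p', q', hg⟩
    refine ⟨p * p' - q * q', p * q' + q * p', fun ω => ?_⟩
    rw [Pi.mul_apply, hf, hg]
    push_cast [map_add, map_sub, map_mul]
    linear_combination ((aeval (torusRealCoord ω) q : ℝ) : ℂ) *
      ((aeval (torusRealCoord ω) q' : ℝ) : ℂ) * Complex.I_mul_I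
  add_mem' := by
    rintro f g ⟨p, q, hf⟩ ⟨p', q', hg⟩
    refine ⟨p + p', q + q', fun ω => ?_⟩
    rw [Pi.add_apply, hf, hg]
    push_cast [map_add]
    ring
  algebraMap_mem' r := ⟨C r, 0, fun ω => by simp⟩

namespace torusPolynomial

variable {d : ℕ} {f : (Fin d → Circle) → ℂ}

theorem exists_zero_iff (hf : f ∈ torusPolynomial d) :
    ∃ p : MvPolynomial (Fin d ⊕ Fin d) ℝ, ∀ ω, aeval (torusRealCoord ω) p = 0 ↔ f ω = 0 := by
  obtain ⟨p, q, h⟩ := hf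
  refine ⟨p ^ 2 + q ^ 2, fun ω => ?_⟩
  rw [h, Complex.ext_iff, map_add, map_pow, map_pow, add_eq_zero_iff_of_nonneg (sq_nonneg _)
    (sq_nonneg _)]
  simp

theorem conj_mem (hf : f ∈ torusPolynomial d) :
    (fun ω => (starRingEnd ℂ) (f ω)) ∈ torusPolynomial d := by
  obtain ⟨p, q, h⟩ := hf
  refine ⟨p, -q, fun ω => ?_⟩
  simp [h]

theorem const_mem (c : ℂ) : (fun _ : Fin d → Circle => c) ∈ torusPolynomial d :=
  ⟨C c.re, C c.im, fun ω => by simp⟩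

theorem coord_mem (i : Fin d) : (fun ω : Fin d → Circle => (ω i : ℂ)) ∈ torusPolynomial d :=
  ⟨X (Sum.inl i), X (Sum.inr i), fun ω => by simp [torusRealCoord]⟩

theorem phase_mem (k : Fin d → ℤ) :
    (fun ω => CrystalFramework.phase ω k) ∈ torusPolynomial d := by
  have h : (fun ω => CrystalFramework.phase ω k) =
      ∏ i, fun ω : Fin d → Circle => ((ω i ^ k i : Circle) : ℂ) := by
    funext ω
    rw [Finset.prod_apply]
    exact map_prod Circle.coeHom _ _
  rw [h]
  refine prod_mem fun i _ => ?_
  obtain ⟨n, hn | hn⟩ := (k i).eq_nat_or_neg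
  · convert pow_mem (coord_mem i) n using 1
    funext ω
    simp [hn]
  -- On the unit circle the inverse is the conjugate, so negative exponents stay polynomial.
  · convert pow_mem (conj_mem (coord_mem i)) n using 1
    funext ω
    simp only [hn, zpow_neg, zpow_natCast, Circle.coe_inv_eq_conj, Circle.coe_pow, map_pow,
      Pi.pow_apply]

theorem det_mem {n : Type*} [Fintype n] [DecidableEq n] {N : (Fin d → Circle) → Matrix n n ℂ}
    (hN : ∀ i j, (fun ω => N ω i j) ∈ torusPolynomial d) :
    (fun ω => (N ω).det) ∈ torusPolynomial d := by
  let N' : Matrix n n (torusPolynomial d) := .of fun i j => ⟨_, hN i j⟩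
  convert N'.det.2 using 1
  funext ω
  exact (RingHom.map_det ((Pi.evalRingHom _ ω).comp (torusPolynomial d).val.toRingHom) N').symm

end torusPolynomial

/-! ### Characters of the lattice and of the torus -/

namespace CrystalFramework

variable {d : ℕ}

theorem phase_zero (ω : Fin d → Circle) : phase ω 0 = 1 := by simp [phase]

theorem phase_add (ω : Fin d → Circle) (k l : Fin d → ℤ) :
    phase ω (k + l) = phase ω k * phase ω l := by
  simp [phase, zpow_add, Finset.prod_mul_distrib]

theorem phase_single (ω : Fin d → Circle) (i : Fin d) : phase ω (Pi.single i 1) = ω i := by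
  rw [phase, Finset.prod_eq_single i] <;> simp +contextual

/-- The character `k ↦ ω^k` of `ℤ^d`. -/
noncomputable def latticeCharacter (ω : Fin d → Circle) : Multiplicative (Fin d → ℤ) →* ℂ where
  toFun k := phase ω k.toAdd
  map_one' := phase_zero ω
  map_mul' k l := phase_add ω k.toAdd l.toAdd

theorem latticeCharacter_injective : Function.Injective (latticeCharacter (d := d)) := by
  intro ω ω' h
  funext i
  have := DFunLike.congr_fun h (Multiplicative.ofAdd (Pi.single i 1))
  simpa [latticeCharacter, phase_single, Circle.coe_inj] using this

theorem linearIndependent_latticeCharacter : LinearIndependent ℂ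
    fun ω : Fin d → Circle => (latticeCharacter ω : Multiplicative (Fin d → ℤ) → ℂ) :=
  (linearIndependent_monoidHom (Multiplicative (Fin d → ℤ)) ℂ).comp latticeCharacter
    latticeCharacter_injective

/-- The character `ω ↦ ω^k` of the torus. -/
noncomputable def torusCharacter (k : Fin d → ℤ) : (Fin d → Circle) →* ℂ where
  toFun ω := phase ω k
  map_one' := by simp [phase]
  map_mul' ω ω' := by simp [phase, mul_zpow, Finset.prod_mul_distrib]

theorem torusCharacter_apply (k : Fin d → ℤ) (ω : Fin d → Circle) :
    torusCharacter k ω = phase ω k := rfl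

theorem torusCharacter_injective : Function.Injective (torusCharacter (d := d)) := by
  intro k l h
  funext i
  -- The angle `1` is not a rational multiple of `2π`, so this point has infinite order and its
  -- powers determine the exponent.
  have := DFunLike.congr_fun h (Pi.mulSingle i (Circle.exp 1))
  have key : ∀ k : Fin d → ℤ, phase (Pi.mulSingle i (Circle.exp 1)) k = Circle.exp (k i) := by
    intro k
    rw [phase, Finset.prod_eq_single i]
    · simp [← Circle.exp_zsmul]
    · intro j _ hj
      simp [hj]
    · simp
  rw [torusCharacter_apply, torusCharacter_apply, key, key, Circle.coe_inj,
    Circle.exp_eq_exp] at this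
  obtain ⟨m, hm⟩ := this
  rcases eq_or_ne m 0 with rfl | hm0
  · simpa using hm
  · refine absurd ?_ (irrational_pi.ne_rat ((k i - l i : ℤ) / (m * 2 : ℤ) : ℚ))
    have : (m : ℝ) ≠ 0 := by exact_mod_cast hm0
    push_cast
    field_simp
    linarith

theorem linearIndependent_torusCharacter :
    LinearIndependent ℂ fun k : Fin d → ℤ => (torusCharacter k : (Fin d → Circle) → ℂ) :=
  (linearIndependent_monoidHom (Fin d → Circle) ℂ).comp torusCharacter torusCharacter_injective

/-! ### The symbol matrix and the RUM spectrum as an algebraic set -/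

variable (C : CrystalFramework d)

theorem rigidityRow_mk {𝕜 : Type} [RCLike 𝕜] (u : C.Displacement 𝕜) (v w : C.Vertex) :
    C.rigidityRow u s(v, w) =
      ∑ σ, ((C.position v σ - C.position w σ : ℝ) : 𝕜) * (u v σ - u w σ) := rfl

theorem position_sub_shift (m : Fin d → ℤ) (v w : C.Vertex) :
    C.position (v.shift m) - C.position (w.shift m) = C.position v - C.position w := by
  simp only [position, VertexLabel.shift, latticeVector, Pi.add_apply, Int.cast_add, add_smul,
    Finset.sum_add_distrib]
  abel

/-- The translate `v ↦ u (v + m)` of a displacement vector `u` has the same rows, translated. -/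
theorem rigidityRow_map_shift {𝕜 : Type} [RCLike 𝕜] (u : C.Displacement 𝕜) (m : Fin d → ℤ)
    (e : Sym2 C.Vertex) :
    C.rigidityRow u (Sym2.map (VertexLabel.shift m) e) =
      C.rigidityRow (fun v => u (VertexLabel.shift m v)) e := by
  induction e using Sym2.ind with
  | _ v w =>
    rw [Sym2.map_mk, rigidityRow_mk, rigidityRow_mk]
    refine Finset.sum_congr rfl fun σ _ => ?_
    congr 2
    exact congrFun (congrArg WithLp.ofLp (C.position_sub_shift m v w)) σ

theorem mem_edgeSet_iff {e : Sym2 C.Vertex} : e ∈ C.graph.edgeSet ↔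
    ∃ k, ∃ e' ∈ C.motifEdges, Sym2.map (VertexLabel.shift k) e' = e := by
  rw [C.edgeSet_eq]
  simp

theorem shift_add (k l : Fin d → ℤ) (v : C.Vertex) :
    VertexLabel.shift k (VertexLabel.shift l v) = VertexLabel.shift (l + k) v := by
  simp [VertexLabel.shift, add_assoc]

theorem shift_zero : (VertexLabel.shift 0 : C.Vertex → C.Vertex) = id := by
  funext v
  simp [VertexLabel.shift]

theorem mem_edgeSet_of_mem_motifEdges {e : Sym2 C.Vertex} (he : e ∈ C.motifEdges) :
    e ∈ C.graph.edgeSet :=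
  C.mem_edgeSet_iff.2 ⟨0, e, he, by rw [shift_zero, Sym2.map_id, id]⟩

theorem map_shift_mem_edgeSet {e : Sym2 C.Vertex} (k : Fin d → ℤ) (he : e ∈ C.graph.edgeSet) :
    Sym2.map (VertexLabel.shift k) e ∈ C.graph.edgeSet := by
  obtain ⟨l, e', he', rfl⟩ := C.mem_edgeSet_iff.1 he
  refine C.mem_edgeSet_iff.2 ⟨l + k, e', he', ?_⟩
  rw [Sym2.map_map]
  congr 1
  funext v
  exact (C.shift_add k l v).symm

theorem rigidityMap_eq_zero_iff {𝕜 : Type} [RCLike 𝕜] {u : C.Displacement 𝕜} :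
    C.rigidityMap 𝕜 u = 0 ↔ ∀ e ∈ C.graph.edgeSet, C.rigidityRow u e = 0 :=
  ⟨fun h e he => congrFun h ⟨e, he⟩, fun h => funext fun e => h e e.2⟩

/-- The phase-periodic displacement vector with given values on the motif vertices. -/
noncomputable def phaseExtend (ω : Fin d → Circle) :
    (Fin C.numVertices × Fin d → ℂ) →ₗ[ℂ] C.Displacement ℂ where
  toFun a v σ := phase ω v.2 * a (v.1, σ)
  map_add' a b := by
    funext v σ
    simp [mul_add]
  map_smul' c a := by
    funext v σ
    simp [mul_left_comm]

theorem phaseExtend_apply (ω : Fin d → Circle) (a : Fin C.numVertices × Fin d → ℂ)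
    (v : C.Vertex) (σ : Fin d) : C.phaseExtend ω a v σ = phase ω v.2 * a (v.1, σ) := rfl

theorem phaseExtend_injective (ω : Fin d → Circle) : Function.Injective (C.phaseExtend ω) := by
  intro a b h
  funext ⟨κ, σ⟩
  simpa [phaseExtend_apply, phase_zero] using congrFun (congrFun h (κ, 0)) σ

theorem phaseExtend_shift (ω : Fin d → Circle) (a : Fin C.numVertices × Fin d → ℂ)
    (m : Fin d → ℤ) :
    (fun v => C.phaseExtend ω a (VertexLabel.shift m v)) = C.phaseExtend ω (phase ω m • a) := by
  funext v σ
  simp only [phaseExtend_apply, VertexLabel.shift, phase_add, Pi.smul_apply, smul_eq_mul]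
  ring

/-- The matrix function of the framework as a linear map: the rigidity map of phase-periodic
displacement vectors in terms of their values on the motif vertices and the motif edges. -/
noncomputable def symbolMap (ω : Fin d → Circle) :
    (Fin C.numVertices × Fin d → ℂ) →ₗ[ℂ] (C.motifEdges → ℂ) :=
  LinearMap.funLeft ℂ ℂ (fun e : C.motifEdges =>
    (⟨e, C.mem_edgeSet_of_mem_motifEdges e.2⟩ : C.graph.edgeSet)) ∘ₗ
      C.rigidityMap ℂ ∘ₗ C.phaseExtend ω

theorem symbolMap_apply (ω : Fin d → Circle) (a : Fin C.numVertices × Fin d → ℂ)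
    (e : C.motifEdges) : C.symbolMap ω a e = C.rigidityRow (C.phaseExtend ω a) e := rfl

/-- The equation of the translate by `k` of a motif edge is that of the motif edge times `ω^k`, so
finitely many equations suffice. -/
theorem symbolMap_eq_zero_iff {ω : Fin d → Circle} {a : Fin C.numVertices × Fin d → ℂ} :
    C.symbolMap ω a = 0 ↔ C.rigidityMap ℂ (C.phaseExtend ω a) = 0 := by
  constructor
  · intro h
    rw [rigidityMap_eq_zero_iff]
    intro e he
    obtain ⟨k, e', he', rfl⟩ := C.mem_edgeSet_iff.1 he
    rw [rigidityRow_map_shift, phaseExtend_shift]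
    have : C.symbolMap ω (phase ω k • a) = 0 := by rw [map_smul, h, smul_zero]
    exact congrFun this ⟨e', he'⟩
  · intro h
    rw [symbolMap, LinearMap.comp_apply, LinearMap.comp_apply, h, map_zero]

theorem mem_rumSpectrum_iff {ω : Fin d → Circle} :
    ω ∈ C.rumSpectrum ↔ ∃ a ≠ 0, C.rigidityMap ℂ (C.phaseExtend ω a) = 0 := by
  rw [rumSpectrum, mem_ofPred_eq, Submodule.ne_bot_iff]
  constructor
  · rintro ⟨⟨u, hu⟩, hker, hne⟩
    have hu' : C.phaseExtend ω (fun j => u (j.1, 0) j.2) = u := by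
      funext ⟨κ, k⟩ σ
      exact (congrFun (hu κ k) σ).symm
    refine ⟨fun j => u (j.1, 0) j.2, fun h => hne ?_, ?_⟩
    · rw [h, map_zero] at hu'
      exact Subtype.ext hu'.symm
    · rw [hu']
      exact hker
  · rintro ⟨a, ha, h⟩
    refine ⟨⟨C.phaseExtend ω a, fun κ k => ?_⟩, h, fun h0 => ha ?_⟩
    · funext σ
      simp [phaseExtend_apply, phase_zero]
    · exact C.phaseExtend_injective ω ((congrArg Subtype.val h0).trans (map_zero _).symm)

/-- The symbol matrix `M` need not be square, but `M* M` is, and it has the same kernel. -/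
theorem mem_rumSpectrum_iff_det {ω : Fin d → Circle} : ω ∈ C.rumSpectrum ↔
    ((LinearMap.toMatrix' (C.symbolMap ω)).conjTranspose *
      LinearMap.toMatrix' (C.symbolMap ω)).det = 0 := by
  rw [mem_rumSpectrum_iff, ← Matrix.exists_mulVec_eq_zero_iff]
  refine exists_congr fun a => and_congr_right fun _ => ?_
  open scoped ComplexOrder in
  rw [← symbolMap_eq_zero_iff, Matrix.conjTranspose_mul_self_mulVec_eq_zero,
    LinearMap.toMatrix'_mulVec]

theorem rigidityRow_phaseExtend_mem (a : Fin C.numVertices × Fin d → ℂ) (e : Sym2 C.Vertex) :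
    (fun ω => C.rigidityRow (C.phaseExtend ω a) e) ∈ torusPolynomial d := by
  induction e using Sym2.ind with
  | _ v w =>
    have h : (fun ω => C.rigidityRow (C.phaseExtend ω a) s(v, w)) =
        ∑ σ, (fun _ => ((C.position v σ - C.position w σ : ℝ) : ℂ)) *
          ((fun ω => phase ω v.2) * (fun _ => a (v.1, σ)) -
            (fun ω => phase ω w.2) * (fun _ => a (w.1, σ))) := by
      funext ω
      simp [rigidityRow_mk, phaseExtend_apply]
    rw [h]
    refine sum_mem fun σ _ => mul_mem (torusPolynomial.const_mem _) (sub_mem ?_ ?_) <;>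
      exact mul_mem (torusPolynomial.phase_mem _) (torusPolynomial.const_mem _)

/-- The RUM spectrum is the zero set of a single real polynomial on the torus. -/
theorem exists_polynomial_rumSpectrum : ∃ p : MvPolynomial (Fin d ⊕ Fin d) ℝ,
    ∀ ω, aeval (torusRealCoord ω) p = 0 ↔ ω ∈ C.rumSpectrum := by
  simp_rw [mem_rumSpectrum_iff_det]
  refine torusPolynomial.exists_zero_iff (torusPolynomial.det_mem fun i j => ?_)
  have hM : ∀ e j, (fun ω => LinearMap.toMatrix' (C.symbolMap ω) e j) ∈ torusPolynomial d := by
    intro e j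
    simp only [LinearMap.toMatrix'_apply, symbolMap_apply]
    exact C.rigidityRow_phaseExtend_mem _ _
  simp only [Matrix.mul_apply, Matrix.conjTranspose_apply]
  have h : (fun ω => ∑ e, star (LinearMap.toMatrix' (C.symbolMap ω) e i) *
      LinearMap.toMatrix' (C.symbolMap ω) e j) = ∑ e,
      (fun ω => (starRingEnd ℂ) (LinearMap.toMatrix' (C.symbolMap ω) e i)) *
        (fun ω => LinearMap.toMatrix' (C.symbolMap ω) e j) := by
    funext ω
    simp
  rw [h]
  exact sum_mem fun e _ => mul_mem (torusPolynomial.conj_mem (hM e i)) (hM e j)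

theorem realVarietyDim_rumSpectrum_iff :
    realVarietyDim C.rumSpectrum = (d : WithBot ℕ∞) ↔ C.rumSpectrum = univ := by
  constructor
  · intro h
    by_contra hne
    obtain ⟨p, hp⟩ := C.exists_polynomial_rumSpectrum
    have hmem : p ∉ faceIdeal d 0 := by
      rw [mem_faceIdeal_zero]
      exact fun h0 => hne (eq_univ_of_forall fun ω => (hp ω).1 (h0 ω))
    have := realVarietyDim_add_one_le hmem fun ω hω => (hp ω).2 hω
    rw [h] at this
    norm_cast at this
    omega
  · intro h
    rw [h, realVarietyDim_univ]

end CrystalFramework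

/-! ### From local floppy modes to full spectrum -/

namespace CrystalFramework

variable {d : ℕ} (C : CrystalFramework d)

/-- The value at `ω` of the Fourier series of a displacement vector `u`, on the motif vertices. -/
noncomputable def fourier (u : C.Displacement ℝ) (ω : Fin d → Circle) :
    Fin C.numVertices × Fin d → ℂ :=
  fun j => ∑ᶠ k, phase ω (-k) * (u (j.1, k) j.2 : ℂ)

variable {C} {u : C.Displacement ℝ}

theorem finite_support_coord (hu : {k : Fin d → ℤ | ∃ κ, u (κ, k) ≠ 0}.Finite)
    (κ : Fin C.numVertices) (σ : Fin d) : {k : Fin d → ℤ | u (κ, k) σ ≠ 0}.Finite :=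
  hu.subset fun k hk => ⟨κ, fun h => hk (by rw [h]; rfl)⟩

/-- Substituting `k = v.2 - m` shows the phase extension to be a sum of the lattice translates of
`u` with weights `ω^m`. Translates of flexes are flexes, so for a finitely supported flex this sum
is one too. -/
theorem phaseExtend_fourier (u : C.Displacement ℝ) (ω : Fin d → Circle) (v : C.Vertex)
    (σ : Fin d) : C.phaseExtend ω (C.fourier u ω) v σ =
      ∑ᶠ m, phase ω m * (u (VertexLabel.shift (-m) v) σ : ℂ) := by
  rw [phaseExtend_apply, fourier, mul_finsum,
    ← finsum_comp_equiv (Equiv.subLeft v.2)]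
  refine finsum_congr fun m => ?_
  rw [← mul_assoc, ← phase_add]
  simp [VertexLabel.shift, sub_eq_add_neg, Equiv.subLeft_apply]

theorem finite_support_shift (hu : {k : Fin d → ℤ | ∃ κ, u (κ, k) ≠ 0}.Finite)
    (ω : Fin d → Circle) (v : C.Vertex) (σ : Fin d) :
    (Function.support fun m => phase ω m * (u (VertexLabel.shift (-m) v) σ : ℂ)).Finite := by
  refine ((finite_support_coord hu v.1 σ).preimage
    (f := fun m => v.2 + -m) (fun a _ b _ h => by simpa using h)).subset fun m hm => ?_
  simp only [Function.mem_support, ne_eq, mul_eq_zero, not_or, Complex.ofReal_eq_zero] at hm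
  exact hm.2

theorem rigidityMap_phaseExtend_fourier (hu : {k : Fin d → ℤ | ∃ κ, u (κ, k) ≠ 0}.Finite)
    (hflex : C.rigidityMap ℝ u = 0) (ω : Fin d → Circle) :
    C.rigidityMap ℂ (C.phaseExtend ω (C.fourier u ω)) = 0 := by
  rw [rigidityMap_eq_zero_iff] at hflex ⊢
  intro e he
  induction e using Sym2.ind with
  | _ v w =>
    rw [rigidityRow_mk]
    have hsub : ∀ σ, C.phaseExtend ω (C.fourier u ω) v σ - C.phaseExtend ω (C.fourier u ω) w σ =
        ∑ᶠ m, (phase ω m * (u (VertexLabel.shift (-m) v) σ : ℂ) -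
          phase ω m * (u (VertexLabel.shift (-m) w) σ : ℂ)) := fun σ => by
      rw [phaseExtend_fourier, phaseExtend_fourier,
        finsum_sub_distrib (finite_support_shift hu ω v σ) (finite_support_shift hu ω w σ)]
    have hfin : ∀ σ, (Function.support fun m =>
        (phase ω m * (u (VertexLabel.shift (-m) v) σ : ℂ) -
          phase ω m * (u (VertexLabel.shift (-m) w) σ : ℂ))).Finite := fun σ =>
      ((finite_support_shift hu ω v σ).union (finite_support_shift hu ω w σ)).subset
        (Function.support_sub _ _)
    simp_rw [hsub, mul_finsum]
    rw [← finsum_sum_comm]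
    · refine (finsum_congr fun m => ?_).trans finsum_zero
      have hrow := hflex _ (C.map_shift_mem_edgeSet (-m) he)
      rw [rigidityRow_map_shift, rigidityRow_mk] at hrow
      have hrow' := congrArg (fun x : ℝ => phase ω m * (x : ℂ)) hrow
      simp only [Complex.ofReal_zero, mul_zero] at hrow'
      rw [← hrow']
      push_cast
      rw [Finset.mul_sum]
      refine Finset.sum_congr rfl fun σ _ => ?_
      simp only [RCLike.ofReal_real_eq_id, id, Complex.coe_algebraMap]
      ring
    · intro σ _
      refine (hfin σ).subset fun m hm => ?_
      simp only [Function.mem_support, ne_eq, mul_eq_zero, not_or] at hm ⊢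
      exact hm.2

theorem fourier_eq_sum (hu : {k : Fin d → ℤ | ∃ κ, u (κ, k) ≠ 0}.Finite)
    (j : Fin C.numVertices × Fin d) (ω : Fin d → Circle) :
    C.fourier u ω j =
      ∑ k ∈ (finite_support_coord hu j.1 j.2).toFinset, phase ω (-k) * (u (j.1, k) j.2 : ℂ) := by
  refine finsum_eq_sum_of_support_subset _ fun k hk => ?_
  simp only [Function.mem_support, ne_eq, mul_eq_zero, not_or, Complex.ofReal_eq_zero] at hk
  simpa using hk.2

theorem fourier_mem (hu : {k : Fin d → ℤ | ∃ κ, u (κ, k) ≠ 0}.Finite)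
    (j : Fin C.numVertices × Fin d) : (fun ω => C.fourier u ω j) ∈ torusPolynomial d := by
  have h : (fun ω => C.fourier u ω j) = ∑ k ∈ (finite_support_coord hu j.1 j.2).toFinset,
      (fun ω => phase ω (-k)) * (fun _ => (u (j.1, k) j.2 : ℂ)) := by
    funext ω
    simp [fourier_eq_sum hu]
  rw [h]
  exact sum_mem fun k _ => mul_mem (torusPolynomial.phase_mem _) (torusPolynomial.const_mem _)

/-- Distinct torus characters are linearly independent, so a trigonometric polynomial that vanishes
everywhere has zero coefficients. -/
theorem exists_fourier_ne_zero (hu : {k : Fin d → ℤ | ∃ κ, u (κ, k) ≠ 0}.Finite) (hne : u ≠ 0) :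
    ∃ j ω, C.fourier u ω j ≠ 0 := by
  by_contra! h
  apply hne
  funext ⟨κ, k⟩ σ
  by_contra hk
  have hind := linearIndependent_torusCharacter (d := d).comp _ neg_injective
  rw [linearIndependent_iff'] at hind
  have := hind (finite_support_coord hu κ σ).toFinset (fun k => (u (κ, k) σ : ℂ)) ?_ k
    (by simpa using hk)
  · exact hk (by simpa using this)
  · funext ω
    rw [Finset.sum_apply]
    refine Eq.trans ?_ ((fourier_eq_sum hu (κ, σ) ω).symm.trans (h (κ, σ) ω))
    refine Finset.sum_congr rfl fun k _ => ?_
    simp only [Function.comp_apply, Pi.smul_apply, torusCharacter_apply, smul_eq_mul]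
    ring

theorem rumSpectrum_eq_univ_of_isLocalFloppyMode (hu : C.IsLocalFloppyMode u) :
    C.rumSpectrum = univ := by
  obtain ⟨hne, hflex, hfin⟩ := hu
  obtain ⟨p, hp⟩ := C.exists_polynomial_rumSpectrum
  obtain ⟨j, ω₀, hω₀⟩ := exists_fourier_ne_zero hfin hne
  obtain ⟨q, hq⟩ := torusPolynomial.exists_zero_iff (fourier_mem hfin j)
  -- Here `p` cuts out the spectrum and `q` the zeros of one Fourier component; each `ω` lies in one
  -- of these sets.
  have hmul : p * q ∈ faceIdeal d 0 := by
    rw [mem_faceIdeal_zero]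
    intro ω
    rw [map_mul, mul_eq_zero, hp, hq, or_iff_not_imp_right]
    intro h
    exact C.mem_rumSpectrum_iff.2 ⟨C.fourier u ω, fun h0 => h (congrFun h0 j),
      rigidityMap_phaseExtend_fourier hfin hflex ω⟩
  rcases (isPrime_faceIdeal d 0).mem_or_mem hmul with h | h
  · exact eq_univ_of_forall fun ω => (hp ω).1 (mem_faceIdeal_zero.1 h ω)
  · exact absurd ((hq ω₀).1 (mem_faceIdeal_zero.1 h ω₀)) hω₀

end CrystalFramework

end

/-! ### From full spectrum to growth of the nullity -/

section

open Set

namespace CrystalFramework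

variable {d : ℕ} {C : CrystalFramework d}

/-- Periodic displacement vectors are determined by their values on the supercell `[0, n)^d`. -/
theorem apply_emod {n : ℕ} {u : C.Displacement ℝ}
    (hu : u ∈ C.periodicDisplacements fun _ => n) (κ : Fin C.numVertices) (k : Fin d → ℤ) :
    u (κ, fun i => k i % n) = u (κ, k) := by
  have h := hu κ k (fun i => -(n * (k i / n))) fun i => (dvd_mul_right _ _).neg_right
  rw [← h]
  congr 2
  funext i
  rw [Pi.add_apply, Int.emod_def, sub_eq_add_neg]

theorem finite_periodicDisplacements {n : ℕ} (hn : 1 ≤ n) :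
    Module.Finite ℝ (C.periodicDisplacements fun _ => n) := by
  let r : (C.periodicDisplacements fun _ => n) →ₗ[ℝ]
      (Fin C.numVertices × (Fin d → Fin n) → Fin d → ℝ) :=
    LinearMap.funLeft ℝ (Fin d → ℝ) (fun x : Fin C.numVertices × (Fin d → Fin n) =>
      ((x.1, fun i => ((x.2 i : ℕ) : ℤ)) : C.Vertex)) ∘ₗ
        (C.periodicDisplacements fun _ => n).subtype
  refine Module.Finite.of_injective r fun u v huv => Subtype.ext (funext fun ⟨κ, k⟩ => ?_)
  have hn' : (0 : ℤ) < n := by exact_mod_cast hn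
  have hlt : ∀ i, (k i % n).toNat < n := fun i => by
    have := Int.emod_lt_of_pos (k i) hn'
    omega
  have h := congrFun huv (κ, fun i => ⟨(k i % n).toNat, hlt i⟩)
  have hk : (fun i => (((k i % n).toNat : ℕ) : ℤ)) = fun i => k i % n :=
    funext fun i => Int.toNat_of_nonneg (Int.emod_nonneg _ hn'.ne')
  simp only [r, LinearMap.comp_apply, LinearMap.funLeft_apply, Submodule.subtype_apply, hk] at h
  rwa [apply_emod u.2, apply_emod v.2] at h

/-- The complexification of a real displacement vector. -/
noncomputable def complexify : C.Displacement ℝ →ₗ[ℝ] C.Displacement ℂ where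
  toFun u v σ := u v σ
  map_add' u w := by
    funext v σ
    simp
  map_smul' c u := by
    funext v σ
    simp

theorem rigidityRow_re (u : C.Displacement ℂ) (e : Sym2 C.Vertex) :
    C.rigidityRow (fun v σ => (u v σ).re) e = (C.rigidityRow u e).re := by
  induction e using Sym2.ind with
  | _ v w => simp [rigidityRow_mk]

theorem rigidityRow_im (u : C.Displacement ℂ) (e : Sym2 C.Vertex) :
    C.rigidityRow (fun v σ => (u v σ).im) e = (C.rigidityRow u e).im := by
  induction e using Sym2.ind with
  | _ v w => simp [rigidityRow_mk]

variable (C) in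
/-- The space of the periodic real infinitesimal flexes. -/
noncomputable def periodicFlexes (n : ℕ) : Submodule ℝ (C.Displacement ℝ) :=
  LinearMap.ker (C.rigidityMap ℝ) ⊓ C.periodicDisplacements fun _ => n

variable (C) in
theorem nullity_eq_finrank (n : ℕ) : C.nullity n = Module.finrank ℝ (C.periodicFlexes n) := by
  let f : C.periodicFlexes n ≃ₗ[ℝ]
      LinearMap.ker ((C.rigidityMap ℝ).domRestrict (C.periodicDisplacements fun _ => n)) :=
    { toFun := fun x => ⟨⟨x.1, x.2.2⟩, x.2.1⟩
      invFun := fun x => ⟨x.1.1, x.2, x.1.2⟩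
      map_add' := fun _ _ => rfl
      map_smul' := fun _ _ => rfl
      left_inv := fun _ => rfl
      right_inv := fun _ => rfl }
  exact f.finrank_eq.symm

/-- A family of complex periodic flexes that is linearly independent over `ℂ` has at most as many
members as the dimension of the space of real periodic flexes. -/
theorem card_le_nullity {n : ℕ} (hn : 1 ≤ n) {ι : Type*} [Fintype ι] {u : ι → C.Displacement ℂ}
    (hu : LinearIndependent ℂ u) (hflex : ∀ j, C.rigidityMap ℂ (u j) = 0)
    (hper : ∀ j κ k m, (∀ i, (n : ℤ) ∣ m i) → u j (κ, k + m) = u j (κ, k)) :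
    Fintype.card ι ≤ C.nullity n := by
  classical
  have := finite_periodicDisplacements (C := C) hn
  have : Module.Finite ℝ (C.periodicFlexes n) :=
    Submodule.finiteDimensional_of_le (inf_le_right : C.periodicFlexes n ≤ _)
  let b := Module.finBasis ℝ (C.periodicFlexes n)
  -- A real basis of the real periodic flexes spans the complex ones over `ℂ`: the rigidity rows
  -- have real coefficients, so real and imaginary parts of a complex flex are flexes.
  have hspan : ∀ x : C.periodicFlexes n, complexify (x : C.Displacement ℝ) ∈
      Submodule.span ℂ (range fun i => complexify (b i : C.Displacement ℝ)) := by
    intro x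
    rw [← b.sum_repr x]
    simp only [Submodule.coe_sum, Submodule.coe_smul, map_sum, map_smul]
    exact sum_mem fun i _ => by
      rw [← Complex.coe_smul]
      exact Submodule.smul_mem _ _ (Submodule.subset_span ⟨i, rfl⟩)
  have hle := linearIndependent_le_span' u hu
    (range fun i => complexify (b i : C.Displacement ℝ)) ?_
  · have h1 : Fintype.card ι ≤ Fintype.card (range fun i =>
        complexify (b i : C.Displacement ℝ)) := by
      rw [Cardinal.mk_fintype] at hle
      exact_mod_cast hle
    refine h1.trans ((Fintype.card_range_le _).trans ?_)
    rw [Fintype.card_fin, nullity_eq_finrank]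
  · rintro _ ⟨j, rfl⟩
    have hW : ∀ x : C.Displacement ℝ, (∀ κ k m, (∀ i, (n : ℤ) ∣ m i) → x (κ, k + m) = x (κ, k)) →
        (∀ e ∈ C.graph.edgeSet, C.rigidityRow x e = 0) → complexify x ∈ Submodule.span ℂ
          (range fun i => complexify (b i : C.Displacement ℝ)) :=
      fun x hx hx' => hspan ⟨x, C.rigidityMap_eq_zero_iff.2 hx', hx⟩
    have hrow := C.rigidityMap_eq_zero_iff.1 (hflex j)
    have hdec : u j = complexify (fun v σ => (u j v σ).re) +
        Complex.I • complexify (fun v σ => (u j v σ).im) := by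
      funext v σ
      simp [complexify, mul_comm Complex.I, Complex.re_add_im]
    rw [hdec]
    refine add_mem (hW _ (fun κ k m hm => by simp [hper j κ k m hm]) fun e he => ?_)
      (Submodule.smul_mem _ _ (hW _ (fun κ k m hm => by simp [hper j κ k m hm]) fun e he => ?_))
    · rw [rigidityRow_re, hrow e he, Complex.zero_re]
    · rw [rigidityRow_im, hrow e he, Complex.zero_im]

/-- At a fixed coordinate `(κ, σ)` a linear relation becomes one between the distinct characters `k
↦ ω^k`; choosing the coordinate where `a j` is nonzero kills the `j`-th coefficient. -/
theorem linearIndependent_phaseExtend {ι : Type*} {ω : ι → Fin d → Circle}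
    (hω : Function.Injective ω) {a : ι → Fin C.numVertices × Fin d → ℂ} (ha : ∀ j, a j ≠ 0) :
    LinearIndependent ℂ fun j => C.phaseExtend (ω j) (a j) := by
  rw [linearIndependent_iff']
  intro s g hg j hj
  obtain ⟨⟨κ, σ⟩, hκ⟩ := Function.ne_iff.1 (ha j)
  have hind := linearIndependent_latticeCharacter.comp ω hω
  rw [linearIndependent_iff'] at hind
  refine (mul_eq_zero.1 (hind s (fun j => g j * a j (κ, σ)) ?_ j hj)).resolve_right hκ
  funext k
  have h := congrFun (congrFun hg (κ, k.toAdd)) σ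
  rw [Finset.sum_apply, Finset.sum_apply] at h
  rw [Finset.sum_apply]
  refine Eq.trans (Finset.sum_congr rfl fun i _ => ?_) h
  have : latticeCharacter (ω i) k = phase (ω i) k.toAdd := rfl
  simp only [Function.comp_apply, Pi.smul_apply, smul_eq_mul, phaseExtend_apply, this]
  ring

theorem pow_le_nullity (h : C.rumSpectrum = univ) {n : ℕ} (hn : 1 ≤ n) : n ^ d ≤ C.nullity n := by
  have : NeZero n := ⟨by omega⟩
  let ω : (Fin d → ZMod n) → Fin d → Circle := fun j i => ZMod.toCircle (j i)
  have hω : Function.Injective ω := fun j l hjl =>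
    funext fun i => ZMod.injective_toCircle (congrFun hjl i)
  choose a ha hflex using fun j => C.mem_rumSpectrum_iff.1 (h ▸ mem_univ (ω j))
  have hcard := card_le_nullity hn (linearIndependent_phaseExtend hω ha) hflex ?_
  · simpa using hcard
  · intro j κ k m hm
    have hone : phase (ω j) m = 1 := by
      rw [phase, Circle.coe_eq_one]
      refine Finset.prod_eq_one fun i _ => ?_
      obtain ⟨q, hq⟩ := hm i
      have hz : (n * q) • j i = 0 := by simp
      rw [hq, ← AddChar.map_zsmul_eq_zpow, hz, AddChar.map_zero_eq_one]
    funext σ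
    rw [phaseExtend_apply, phaseExtend_apply, phase_add, hone, mul_one]

end CrystalFramework

/-! ### From growth of the nullity to local floppy modes -/

namespace CrystalFramework

variable {d : ℕ} {C : CrystalFramework d}

variable (C) in
/-- The cells of the two ends of an edge differ by a bounded amount. -/
theorem exists_edge_bound : ∃ R : ℕ, ∀ v w : C.Vertex, s(v, w) ∈ C.graph.edgeSet →
    ∀ i, |v.2 i - w.2 i| ≤ R := by
  have hloc : ∀ e : Sym2 C.Vertex, ∃ R : ℕ, ∀ v w, e = s(v, w) → ∀ i, |v.2 i - w.2 i| ≤ R := by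
    intro e
    induction e using Sym2.ind with
    | _ v w =>
      refine ⟨∑ i, (v.2 i - w.2 i).natAbs, fun v' w' h i => ?_⟩
      have hi : (v.2 i - w.2 i).natAbs ≤ ∑ i, (v.2 i - w.2 i).natAbs :=
        Finset.single_le_sum (f := fun i => (v.2 i - w.2 i).natAbs) (fun _ _ => Nat.zero_le _)
          (Finset.mem_univ i)
      have hi' : |v.2 i - w.2 i| ≤ ((∑ i, (v.2 i - w.2 i).natAbs : ℕ) : ℤ) := by
        rw [Int.abs_eq_natAbs]
        exact_mod_cast hi
      rcases Sym2.eq_iff.1 h with ⟨rfl, rfl⟩ | ⟨rfl, rfl⟩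
      · exact hi'
      · rwa [abs_sub_comm]
  choose R hR using hloc
  refine ⟨C.motifEdges.sup R, fun v w h i => ?_⟩
  obtain ⟨k, e, he, hk⟩ := C.mem_edgeSet_iff.1 h
  have hle : R e ≤ C.motifEdges.sup R := Finset.le_sup he
  induction e using Sym2.ind with
  | _ v' w' =>
    have h1 := hR s(v', w') v' w' rfl i
    have h2 : |v.2 i - w.2 i| = |v'.2 i - w'.2 i| := by
      rw [Sym2.map_mk] at hk
      rcases Sym2.eq_iff.1 hk with ⟨rfl, rfl⟩ | ⟨rfl, rfl⟩
      · simp [VertexLabel.shift]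
      · rw [abs_sub_comm]
        simp [VertexLabel.shift]
    rw [h2]
    exact h1.trans (by exact_mod_cast hle)

/-- A nonzero periodic flex that vanishes on a boundary layer of the supercell, whose width bounds
the length of the edges, cuts off to a local floppy mode. -/
theorem exists_isLocalFloppyMode_of_vanishing {n R : ℕ} (hn : 1 ≤ n)
    (hR : ∀ v w : C.Vertex, s(v, w) ∈ C.graph.edgeSet → ∀ i, |v.2 i - w.2 i| ≤ R)
    {u : C.Displacement ℝ} (hper : u ∈ C.periodicDisplacements fun _ => n)
    (hflex : C.rigidityMap ℝ u = 0) (hne : u ≠ 0)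
    (hbd : ∀ v : C.Vertex, v.2 ∈ Fintype.piFinset (fun _ => Finset.Ico (0 : ℤ) n) →
      v.2 ∉ Fintype.piFinset (fun _ => Finset.Ico (R : ℤ) (n - R)) → u v = 0) :
    ∃ w, C.IsLocalFloppyMode w := by
  classical
  let B : Finset (Fin d → ℤ) := Fintype.piFinset (fun _ => Finset.Ico (0 : ℤ) n)
  let w : C.Displacement ℝ := fun v => if v.2 ∈ B then u v else 0
  -- An edge leaving the box has its inner end in the boundary layer, so the cut-off is zero at both
  -- ends.
  have hmix : ∀ v v' : C.Vertex, s(v, v') ∈ C.graph.edgeSet → v.2 ∈ B → v'.2 ∉ B → u v = 0 := by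
    intro v v' he hv hv'
    refine hbd v hv fun hint => hv' ?_
    simp only [B, Fintype.mem_piFinset, Finset.mem_Ico] at hint ⊢
    intro i
    have h1 := abs_le.1 (hR v v' he i)
    have h2 := hint i
    omega
  refine ⟨w, fun h0 => hne ?_, ?_, ?_⟩
  · funext ⟨κ, k⟩
    have hn' : (0 : ℤ) < n := by exact_mod_cast hn
    have hk : (fun i => k i % n) ∈ B := by
      simp only [B, Fintype.mem_piFinset, Finset.mem_Ico]
      exact fun i => ⟨Int.emod_nonneg _ hn'.ne', Int.emod_lt_of_pos _ hn'⟩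
    have h := congrFun h0 (κ, fun i => k i % n)
    simp only [w, if_pos hk] at h
    rw [← apply_emod hper, h]
    rfl
  · rw [rigidityMap_eq_zero_iff] at hflex ⊢
    intro e he
    induction e using Sym2.ind with
    | _ v v' =>
      have h := hflex _ he
      rw [rigidityRow_mk] at h ⊢
      by_cases hv : v.2 ∈ B <;> by_cases hv' : v'.2 ∈ B
      · simpa only [w, if_pos hv, if_pos hv'] using h
      · simp [w, hv, hv', hmix v v' he hv hv']
      · simp [w, hv, hv', hmix v' v (by rwa [Sym2.eq_swap]) hv' hv]
      · simp [w, hv, hv']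
  · refine B.finite_toSet.subset ?_
    rintro k ⟨κ, hk⟩
    by_contra hkB
    exact hk (if_neg hkB)

/-- The count is `n^d - (n - 2R)^d`; Bernoulli's inequality for `(1 - 2R/n)^d` bounds it. -/
theorem card_boundary_le {n R d : ℕ} (h : 2 * R ≤ n) (h0 : 1 ≤ n) :
    ((((Fintype.piFinset (fun _ : Fin d => Finset.Ico (0 : ℤ) n)) \
      (Fintype.piFinset (fun _ => Finset.Ico (R : ℤ) (n - R)))).card : ℕ) : ℝ) ≤
        2 * R * d / n * n ^ d := by
  have hsub : Fintype.piFinset (fun _ : Fin d => Finset.Ico (R : ℤ) (n - R)) ⊆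
      Fintype.piFinset (fun _ : Fin d => Finset.Ico (0 : ℤ) n) :=
    Fintype.piFinset_subset _ _ fun _ => Finset.Ico_subset_Ico (by omega) (by omega)
  have hn : (0 : ℝ) < n := by exact_mod_cast h0
  have hRn : 2 * (R : ℝ) ≤ n := by exact_mod_cast h
  have hc : ((n : ℤ) - R - R).toNat = n - 2 * R := by omega
  rw [Finset.card_sdiff_of_subset hsub, Nat.cast_sub (Finset.card_le_card hsub)]
  simp only [Fintype.card_piFinset_const, Int.card_Ico, hc, sub_zero, Int.toNat_natCast]
  push_cast [Nat.cast_sub h]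
  have hb := one_add_mul_le_pow (a := -(2 * (R : ℝ) / n)) (by
    have : 2 * (R : ℝ) / n ≤ 1 := (div_le_one hn).2 hRn
    linarith) d
  have hmul := mul_le_mul_of_nonneg_right hb (pow_nonneg hn.le d)
  rw [← mul_pow] at hmul
  have he : (1 + -(2 * (R : ℝ) / n)) * n = n - 2 * R := by
    field_simp
    ring
  rw [he] at hmul
  have he' : (1 + (d : ℝ) * -(2 * (R : ℝ) / n)) * n ^ d = n ^ d - 2 * R * d / n * n ^ d := by
    ring
  linarith

theorem exists_isLocalFloppyMode_of_nullity {c : ℝ} (hc : 0 < c)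
    (h : ∀ n : ℕ, 1 ≤ n → c * (n : ℝ) ^ d ≤ (C.nullity n : ℝ)) :
    ∃ u, C.IsLocalFloppyMode u := by
  obtain ⟨R, hR⟩ := C.exists_edge_bound
  obtain ⟨N, hN⟩ := exists_nat_gt (C.numVertices * d * (2 * R * d) / c : ℝ)
  -- `N` makes the boundary conditions fewer than `c n^d`; the rest ensures `2R ≤ n` and `1 ≤ n`.
  let n := N + 2 * R + 1
  have hn : 1 ≤ n := by omega
  have hn0 : (0 : ℝ) < n := by exact_mod_cast hn
  let B : Finset (Fin d → ℤ) := Fintype.piFinset (fun _ => Finset.Ico (0 : ℤ) n) \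
    Fintype.piFinset (fun _ => Finset.Ico (R : ℤ) (n - R))
  let r : C.periodicFlexes n →ₗ[ℝ] (Fin C.numVertices × B × Fin d → ℝ) :=
    { toFun := fun x j => (x : C.Displacement ℝ) (j.1, j.2.1) j.2.2
      map_add' := fun _ _ => rfl
      map_smul' := fun _ _ => rfl }
  have hB : (B.card : ℝ) ≤ 2 * R * d / n * n ^ d := card_boundary_le (by omega) hn
  have hlt : Module.finrank ℝ (Fin C.numVertices × B × Fin d → ℝ) <
      Module.finrank ℝ (C.periodicFlexes n) := by
    have hnull := h n hn
    rw [nullity_eq_finrank] at hnull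
    rw [Module.finrank_fintype_fun_eq_card, Fintype.card_prod, Fintype.card_prod, Fintype.card_coe,
      Fintype.card_fin, Fintype.card_fin, ← Nat.cast_lt (α := ℝ)]
    refine lt_of_lt_of_le ?_ hnull
    push_cast
    have hN' : (C.numVertices * d * (2 * R * d) : ℝ) < c * n := by
      rw [div_lt_iff₀ hc] at hN
      have : (N : ℝ) ≤ n := by exact_mod_cast (by omega : N ≤ n)
      nlinarith
    calc (C.numVertices : ℝ) * (B.card * d)
        = C.numVertices * d * B.card := by ring
      _ ≤ C.numVertices * d * (2 * R * d / n * n ^ d) := by gcongr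
      _ = C.numVertices * d * (2 * R * d) / n * n ^ d := by ring
      _ < c * n ^ d := by
        gcongr
        rwa [div_lt_iff₀ hn0]
  -- A positive `finrank` rules out its default value `0` for infinite dimension.
  have := Module.finite_of_finrank_pos (Nat.zero_lt_of_lt hlt)
  obtain ⟨x, hx, hx0⟩ := Submodule.exists_mem_ne_zero_of_ne_bot (r.ker_ne_bot_of_finrank_lt hlt)
  refine exists_isLocalFloppyMode_of_vanishing hn hR x.2.2 x.2.1
    (fun h0 => hx0 (Subtype.ext h0)) fun v hv hv' => funext fun σ => ?_
  exact congrFun hx (v.1, ⟨v.2, Finset.mem_sdiff.2 ⟨hv, hv'⟩⟩, σ)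

end CrystalFramework

end

theorem corollary4p3 (d : ℕ) (C : CrystalFramework d) :
    List.TFAE [
      ∃ u, C.IsLocalFloppyMode u,
      ∃ c : ℝ, 0 < c ∧ ∀ n : ℕ, 1 ≤ n → c * (n : ℝ) ^ d ≤ (C.nullity n : ℝ),
      realVarietyDim C.rumSpectrum = (d : WithBot ℕ∞),
      C.rumSpectrum = Set.univ] := by
  tfae_have 1 → 4 := fun ⟨_, hu⟩ =>
    CrystalFramework.rumSpectrum_eq_univ_of_isLocalFloppyMode hu
  tfae_have 4 → 2 := fun h => ⟨1, one_pos, fun n hn => by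
    rw [one_mul]
    exact_mod_cast CrystalFramework.pow_le_nullity h hn⟩
  tfae_have 2 → 1 := fun ⟨_, hc, h⟩ => CrystalFramework.exists_isLocalFloppyMode_of_nullity hc h
  tfae_have 3 ↔ 4 := C.realVarietyDim_rumSpectrum_iff
  tfae_finish
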